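/- Let $n\ge 1$. For $x=(x_1,\dots,x_n)\in\mathbb R^n$ put $\operatorname{Nm}x=x_1x_2\cdots x_n$, and let $|x|$ be the Euclidean norm. For a full-rank lattice $L\subset\mathbb R^n$ define its Diophantine characteristic $$\nu(L,\rho)=\min\{|\operatorname{Nm}\gamma| : \gamma\in L,\ 0<|\gamma|<\rho\},\qquad \rho>\min\{|\gamma| : \gamma\in L\setminus\{0\}\}.$$ Let $\Lambda\subset\mathbb R^n$ be a unimodular lattice (a full-rank lattice of covolume $1$) and let $P\in \mathrm{GL}(n,\mathbb R)$. Then for almost every $U\in\mathrm{SO}(n)$, with respect to Haar measure on $\mathrm{SO}(n)$, the following holds: for every $\varepsilon>0$ there is $\rho_0$ (which may depend on $n,\Lambda,P,U,\varepsilon$) such that $$\nu(PU\Lambda,\rho)>(\log\rho)^{1-n-\varepsilon}\qquad\text{for all }\rho\ge\rho_0 .$$ -/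

import Mathlib

noncomputable section

/-- The norm form `Nm x = x₁ x₂ ⋯ xₙ` on `ℝⁿ`. -/
def normForm {n : ℕ} (x : EuclideanSpace ℝ (Fin n)) : ℝ := ∏ i, x i

/-- The image `A Λ = {A γ : γ ∈ Λ}` of an additive subgroup `Λ` of `ℝⁿ` under a real matrix `A`
acting on column vectors. -/
def matrixImage {n : ℕ} (A : Matrix (Fin n) (Fin n) ℝ)
    (L : Submodule ℤ (EuclideanSpace ℝ (Fin n))) : Submodule ℤ (EuclideanSpace ℝ (Fin n)) :=
  L.map ((Matrix.toEuclideanLin A).restrictScalars ℤ)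

/-- The set of values `{|Nm γ| : γ ∈ Λ, 0 < |γ| < ρ}`, with `|γ|` the Euclidean norm. -/
def normFormValues {n : ℕ} (L : Submodule ℤ (EuclideanSpace ℝ (Fin n))) (ρ : ℝ) : Set ℝ :=
  {t | ∃ γ ∈ L, 0 < ‖γ‖ ∧ ‖γ‖ < ρ ∧ t = |normForm γ|}

/-- The Diophantine characteristic `ν(Λ, ρ) = min {|Nm γ| : γ ∈ Λ, 0 < |γ| < ρ}`. It is written
as an infimum; for a lattice `Λ` and `ρ > min {|γ| : γ ∈ Λ \ {0}}` the minimum is attained, see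
`isLeast_diophantineChar`. -/
def diophantineChar {n : ℕ} (L : Submodule ℤ (EuclideanSpace ℝ (Fin n))) (ρ : ℝ) : ℝ :=
  sInf (normFormValues L ρ)

theorem mem_matrixImage {n : ℕ} (A : Matrix (Fin n) (Fin n) ℝ)
    (L : Submodule ℤ (EuclideanSpace ℝ (Fin n))) (x : EuclideanSpace ℝ (Fin n)) :
    x ∈ matrixImage A L ↔ ∃ γ ∈ L, WithLp.toLp 2 (A.mulVec γ.ofLp) = x := by
  simp [matrixImage, Submodule.mem_map, Matrix.toLpLin_apply]

/-- For a discrete subgroup the infimum defining `ν(Λ, ρ)` is a minimum, as soon as `Λ` has a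
nonzero vector of length less than `ρ`. -/
theorem isLeast_diophantineChar {n : ℕ} (L : Submodule ℤ (EuclideanSpace ℝ (Fin n)))
    [DiscreteTopology L] (ρ : ℝ) (hρ : ∃ γ ∈ L, γ ≠ 0 ∧ ‖γ‖ < ρ) :
    IsLeast (normFormValues L ρ) (diophantineChar L ρ) := by
  have hfin : (Metric.closedBall (0 : EuclideanSpace ℝ (Fin n)) ρ ∩
      (L.toAddSubgroup : Set (EuclideanSpace ℝ (Fin n)))).Finite := by
    have : DiscreteTopology L.toAddSubgroup := inferInstanceAs (DiscreteTopology L)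
    exact Metric.finite_isBounded_inter_isClosed DiscreteTopology.isDiscrete
      Metric.isBounded_closedBall
      (AddSubgroup.isClosed_of_discrete (H := L.toAddSubgroup))
  have hfin' : (normFormValues L ρ).Finite := by
    refine (hfin.image (fun γ => |normForm γ|)).subset ?_
    rintro t ⟨γ, hγ, -, hlt, rfl⟩
    exact ⟨γ, ⟨by simpa using hlt.le, hγ⟩, rfl⟩
  obtain ⟨γ, hγ, h0, hlt⟩ := hρ
  have hne : (normFormValues L ρ).Nonempty := ⟨_, γ, hγ, norm_pos_iff.mpr h0, hlt, rfl⟩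
  exact ⟨hne.csInf_mem hfin', fun t ht => csInf_le hfin'.bddBelow ht⟩

end

/-!
For a nonzero vector `v` the orbit `U v`, with `U` Haar-distributed on `SO(n)`, is uniformly
distributed on the sphere of radius `|v|`. Hence, for `n ≥ 2`, the probability that
`|Nm (P U v)| ≤ t |v|ⁿ` does not depend on `v`, and averaging over `v` in the unit ball shows that
it is proportional to the volume of the cone piece `{|x| ≤ 1, |Nm (P x)| ≤ t |x|ⁿ}`
(`exists_measure_prod_le_mul_norm_pow_le`). On that cone the largest coordinate of `P x` is
comparable to `|x|`, so it can be divided out: what is left is the volume of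
`{u ∈ [-1, 1]ⁿ⁻¹ : ∏ |uᵢ| ≤ t}`, which is `O(t (1 + log (1/t))ⁿ⁻²)`
(`volume_cubeProdSublevel_le`, `volume_prod_le_pow_norm_le`). The exponent `n - 2`, one less than
for the region `|Nm x| ≤ t` in a full cube, is what makes the exponent `1 - n - ε` attainable.

The dyadic shell `2ᵏ ≤ |γ| < 2ᵏ⁺¹` contains `O(2ᵏⁿ)` lattice vectors
(`exists_ncard_lattice_ball_le`), and a vector of it violates `|Nm (P U γ)| > k^(1 - n - δ)` with
probability `O(2⁻ᵏⁿ k^(1 - n - δ) kⁿ⁻²)`. The total for the shell is `O(k^(-1 - δ))`, which is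
summable, so by the Borel–Cantelli lemma almost every `U` has only finitely many bad shells
(`ae_eventually_shell_lt_prod`). The finitely many remaining vectors have `Nm (P U γ) ≠ 0` almost
surely (`ae_prod_ne_zero`), so they only contribute a positive constant, while
`k = O(log ρ)` for the vectors with `|P U γ| < ρ`; the loss of constants is absorbed by `δ < ε`
(`eventually_lt_diophantineChar`). For `n = 1` the norm form is the norm up to sign, and the claim
holds for every `U`.

Throughout, the logarithmic factor is carried by an auxiliary real `L ≥ 0` with `exp (-L) ≤ t`,
in place of `log (1/t)`. The estimates are then monotone in `t`, also for `t > 1`, and `L` stays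
the same when `t` is enlarged.
-/

open MeasureTheory Filter

/-! ### The volume of the sublevel sets of a product of coordinates in a cube -/

/-- The part of the cube `[-1, 1]ᵐ` on which the product of the absolute values of the coordinates
is at most `t`. -/
def cubeProdSublevel (m : ℕ) (t : ℝ) : Set (Fin m → ℝ) :=
  {x | (∀ i, |x i| ≤ 1) ∧ ∏ i, |x i| ≤ t}

theorem measurableSet_cubeProdSublevel (m : ℕ) (t : ℝ) :
    MeasurableSet (cubeProdSublevel m t) := by
  have h : IsClosed (cubeProdSublevel m t) := by
    unfold cubeProdSublevel
    simp only [Set.ofPred_and, Set.ofPred_forall]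
    refine (isClosed_iInter fun i => isClosed_le (by fun_prop) (by fun_prop)).inter
      (isClosed_le (by fun_prop) (by fun_prop))
  exact h.measurableSet

theorem volume_cube_le (m : ℕ) (s : Set (Fin m → ℝ)) (hs : ∀ x ∈ s, ∀ i, |x i| ≤ 1) :
    volume s ≤ ENNReal.ofReal (2 ^ m) := by
  have h : s ⊆ Set.Icc (fun _ => -1) (fun _ => 1) := fun x hx =>
    ⟨fun i => (abs_le.1 (hs x hx i)).1, fun i => (abs_le.1 (hs x hx i)).2⟩
  refine (measure_mono h).trans (le_of_eq ?_)
  rw [Real.volume_Icc_pi]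
  norm_num [ENNReal.ofReal_pow]

theorem lintegral_div_le {t L : ℝ} (ht : 0 < t) (ht1 : t ≤ 1) (hL : Real.exp (-L) ≤ t) :
    ∫⁻ u in Set.Icc t 1, ENNReal.ofReal (t / u) ≤ ENNReal.ofReal (t * L) := by
  have hcont : ContinuousOn (fun u : ℝ => t / u) (Set.Icc t 1) := by
    refine continuousOn_const.div continuousOn_id fun u hu => ?_
    exact (ht.trans_le hu.1).ne'
  rw [← ofReal_integral_eq_lintegral_ofReal (hcont.integrableOn_Icc)]
  · apply ENNReal.ofReal_le_ofReal
    rw [integral_Icc_eq_integral_Ioc, ← intervalIntegral.integral_of_le ht1]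
    simp only [div_eq_mul_inv]
    rw [intervalIntegral.integral_const_mul, integral_inv_of_pos ht one_pos, one_div,
      Real.log_inv]
    have := (Real.le_log_iff_exp_le ht).2 hL
    gcongr
    linarith
  · filter_upwards [ae_restrict_mem measurableSet_Icc] with u hu
    exact div_nonneg ht.le (ht.le.trans hu.1)

/-- The integrand is `min 1 (t / |u|)`, written so that it equals `1` at `u = 0` too, where
`t / |u|` would be `0`. -/
theorem lintegral_truncated_div_le {t L : ℝ} (ht : 0 < t) (hL0 : 0 ≤ L)
    (hL : Real.exp (-L) ≤ t) :
    ∫⁻ u in Set.Icc (-1 : ℝ) 1, ENNReal.ofReal (t / max t |u|) ≤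
      ENNReal.ofReal (2 * t * (1 + L)) := by
  have hle : ∀ u : ℝ, ENNReal.ofReal (t / max t |u|) ≤ 1 := fun u =>
    ENNReal.ofReal_le_one.2 (div_le_one_of_le₀ (le_max_left _ _) (ht.le.trans (le_max_left _ _)))
  rcases le_or_gt 1 t with h1 | h1
  · calc _ ≤ ∫⁻ u in Set.Icc (-1 : ℝ) 1, 1 :=
          lintegral_mono fun u => hle u
      _ = ENNReal.ofReal 2 := by simp; norm_num
      _ ≤ _ := ENNReal.ofReal_le_ofReal (by nlinarith)
  · have hsub : Set.Icc (-1 : ℝ) 1 ⊆ (Set.Icc (-t) t) ∪ (Set.Icc t 1 ∪ -Set.Icc t 1) := by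
      intro u hu
      simp only [Set.mem_union, Set.mem_Icc, Set.mem_neg] at *
      grind
    have hneg : ∫⁻ u in -Set.Icc t 1, ENNReal.ofReal (t / max t |u|) =
        ∫⁻ u in Set.Icc t 1, ENNReal.ofReal (t / max t |u|) := by
      rw [← (Measure.measurePreserving_neg (volume : Measure ℝ)).setLIntegral_comp_preimage_emb
        (MeasurableEquiv.neg ℝ).measurableEmbedding _ (Set.Icc t 1)]
      simp
    have hmid : ∫⁻ u in Set.Icc t 1, ENNReal.ofReal (t / max t |u|) ≤
        ENNReal.ofReal (t * L) := by
      refine le_trans (setLIntegral_mono (by fun_prop) fun u hu => ?_)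
        (lintegral_div_le ht h1.le hL)
      apply ENNReal.ofReal_le_ofReal
      rw [abs_of_pos (ht.trans_le hu.1)]
      rw [max_eq_right hu.1]
    calc _ ≤ ∫⁻ u in (Set.Icc (-t) t) ∪ (Set.Icc t 1 ∪ -Set.Icc t 1),
            ENNReal.ofReal (t / max t |u|) := lintegral_mono_set hsub
      _ ≤ (∫⁻ u in Set.Icc (-t) t, ENNReal.ofReal (t / max t |u|)) +
          ((∫⁻ u in Set.Icc t 1, ENNReal.ofReal (t / max t |u|)) +
           ∫⁻ u in -Set.Icc t 1, ENNReal.ofReal (t / max t |u|)) :=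
          (lintegral_union_le _ _ _).trans (add_le_add le_rfl (lintegral_union_le _ _ _))
      _ ≤ ENNReal.ofReal (2 * t) + (ENNReal.ofReal (t * L) + ENNReal.ofReal (t * L)) := by
          rw [hneg]
          refine add_le_add ?_ (add_le_add hmid hmid)
          calc _ ≤ ∫⁻ u in Set.Icc (-t) t, 1 := lintegral_mono fun u => hle u
            _ = _ := by
              rw [setLIntegral_one, Real.volume_Icc]
              ring_nf
      _ = _ := by
          rw [← ENNReal.ofReal_add (by positivity) (by positivity),
            ← ENNReal.ofReal_add (by positivity) (by positivity)]
          ring_nf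

/-- Slicing a subset of `ℝᵐ⁺¹` along the `j`-th coordinate. -/
theorem volume_eq_lintegral_slice {m : ℕ} (j : Fin (m + 1)) {s : Set (Fin (m + 1) → ℝ)}
    (hs : MeasurableSet s) :
    volume s = ∫⁻ u : ℝ, volume {z : Fin m → ℝ | j.insertNth (α := fun _ => ℝ) u z ∈ s} := by
  have h := (volume_preserving_piFinSuccAbove (fun _ : Fin (m + 1) => ℝ) j).symm
  rw [← h.measure_preimage_equiv, Measure.volume_eq_prod,
    Measure.prod_apply (h.measurable hs)]
  rfl

/-- Induction on the dimension: the slice at first coordinate `u` is the sublevel set for `t / |u|`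
if `|u| > t`, and is at most the whole cube otherwise. -/
theorem volume_cubeProdSublevel_le (k : ℕ) {L : ℝ} (hL0 : 0 ≤ L) {t : ℝ} (ht : 0 < t)
    (hL : Real.exp (-L) ≤ t) :
    volume (cubeProdSublevel (k + 1) t) ≤ ENNReal.ofReal (2 ^ (k + 1) * t * (1 + L) ^ k) := by
  induction k generalizing t with
  | zero =>
    have h : cubeProdSublevel 1 t ⊆ Set.Icc (fun _ => -t) (fun _ => t) := by
      rintro x ⟨-, hx⟩
      have hx : |x 0| ≤ t := by simpa using hx
      refine ⟨fun i => ?_, fun i => ?_⟩ <;> rw [Subsingleton.elim i 0]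
      exacts [(abs_le.1 hx).1, (abs_le.1 hx).2]
    refine (measure_mono h).trans (le_of_eq ?_)
    rw [Real.volume_Icc_pi]
    simp only [Fin.prod_univ_succ, Finset.univ_eq_empty, Finset.prod_empty, mul_one]
    ring_nf
  | succ k ih =>
    have hslice : ∀ u : ℝ, volume {z : Fin (k + 1) → ℝ |
        (0 : Fin (k + 2)).insertNth (α := fun _ => ℝ) u z ∈ cubeProdSublevel (k + 2) t} ≤
        (Set.Icc (-1 : ℝ) 1).indicator (fun u => ENNReal.ofReal (2 ^ (k + 1) * (1 + L) ^ k) *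
          ENNReal.ofReal (t / max t |u|)) u := by
      intro u
      by_cases hu : u ∈ Set.Icc (-1 : ℝ) 1
      · rw [Set.indicator_of_mem hu, ← ENNReal.ofReal_mul (by positivity)]
        rcases le_or_gt |u| t with hut | hut
        · refine (volume_cube_le (k + 1) _ ?_).trans (ENNReal.ofReal_le_ofReal ?_)
          · rintro z ⟨hz, -⟩ i
            simpa using hz i.succ
          · rw [max_eq_left hut, div_self ht.ne', mul_one]
            exact le_mul_of_one_le_right (by positivity) (one_le_pow₀ (by linarith))
        · have hu0 : 0 < |u| := ht.trans hut
          have hu1 : |u| ≤ 1 := abs_le.2 hu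
          have htu : t ≤ t / |u| := by rw [le_div_iff₀ hu0]; nlinarith
          refine (measure_mono ?_).trans ((ih (div_pos ht hu0) (hL.trans htu)).trans
            (ENNReal.ofReal_le_ofReal ?_))
          · rintro z ⟨hz, hp⟩
            refine ⟨fun i => by simpa using hz i.succ, ?_⟩
            rw [le_div_iff₀ hu0]
            simpa [Fin.prod_univ_succ, mul_comm] using hp
          · rw [max_eq_right hut.le]
            apply le_of_eq; ring
      · rw [Set.indicator_of_notMem hu]
        refine le_of_eq (measure_mono_null (t := ∅) ?_ measure_empty)
        rintro z ⟨hz, -⟩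
        exact hu (abs_le.1 (by simpa using hz 0))
    rw [volume_eq_lintegral_slice 0 (measurableSet_cubeProdSublevel _ _)]
    refine (lintegral_mono hslice).trans ?_
    rw [lintegral_indicator measurableSet_Icc, lintegral_const_mul _ (by fun_prop)]
    refine (mul_le_mul_right (lintegral_truncated_div_le ht hL0 hL) _).trans (le_of_eq ?_)
    rw [← ENNReal.ofReal_mul (by positivity)]
    ring_nf

/-! ### The cone of small norm form -/

theorem exists_abs_eq_norm {m : ℕ} (y : Fin (m + 1) → ℝ) : ∃ j, ‖y‖ = |y j| := by
  obtain ⟨j, -, hj⟩ := Finset.exists_max_image Finset.univ (fun i => |y i|) Finset.univ_nonempty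
  refine ⟨j, le_antisymm ?_ (norm_le_pi_norm y j)⟩
  exact (pi_norm_le_iff_of_nonneg (abs_nonneg _)).2 fun i => hj i (Finset.mem_univ i)

open scoped Pointwise in
/-- The set on the left is `|s| • cubeProdSublevel m t` for `s ≠ 0`. -/
theorem volume_scaled_cubeProdSublevel_le {m : ℕ} (t s : ℝ) :
    volume {z : Fin m → ℝ | (∀ i, |z i| ≤ |s|) ∧ ∏ i, |z i| ≤ t * |s| ^ m} ≤
      ENNReal.ofReal (|s| ^ m) * volume (cubeProdSublevel m t) := by
  rcases eq_or_ne s 0 with rfl | hs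
  · rcases m with _ | m
    · refine (measure_mono ?_).trans (one_mul (volume (cubeProdSublevel 0 t))).symm.le |>.trans ?_
      · rintro z ⟨-, hz⟩
        exact ⟨fun i => i.elim0, by simpa using hz⟩
      · simp
    · refine (measure_mono (t := {0}) ?_).trans ?_
      · rintro z ⟨hz, -⟩
        ext i
        simpa using hz i
      · simp
  · have h0 : 0 < |s| := abs_pos.2 hs
    have hsub : {z : Fin m → ℝ | (∀ i, |z i| ≤ |s|) ∧ ∏ i, |z i| ≤ t * |s| ^ m} ⊆
        |s| • cubeProdSublevel m t := by
      rintro z ⟨hz, hp⟩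
      rw [Set.mem_smul_set_iff_inv_smul_mem₀ h0.ne']
      have habs : ∀ i, |(|s|⁻¹ • z) i| = |z i| / |s| := fun i => by
        simp [abs_mul, div_eq_inv_mul]
      refine ⟨fun i => ?_, ?_⟩
      · rw [habs, div_le_one h0]
        exact hz i
      · simp only [habs, Finset.prod_div_distrib, Finset.prod_const, Finset.card_univ,
          Fintype.card_fin]
        rwa [div_le_iff₀ (pow_pos h0 _)]
    refine (measure_mono hsub).trans (le_of_eq ?_)
    rw [Measure.addHaar_smul]
    simp [abs_of_nonneg]

/-- With `‖·‖` the supremum norm, the region is covered by the pieces on which the `j`-th coordinate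
is the largest. Slicing the piece along that coordinate `s` leaves a sublevel set in dimension one
less, scaled by `|s|`; this is why the exponent of `1 + L` is `m` for `ℝᵐ⁺²`. -/
theorem volume_prod_le_pow_norm_le (m : ℕ) {R t L : ℝ} (hR : 0 ≤ R) (hL0 : 0 ≤ L) (ht : 0 < t)
    (hL : Real.exp (-L) ≤ t) :
    volume {y : Fin (m + 2) → ℝ | ‖y‖ ≤ R ∧ ∏ i, |y i| ≤ t * ‖y‖ ^ (m + 2)} ≤
      ENNReal.ofReal (((m + 2) * (2 * R) * R ^ (m + 1) * 2 ^ (m + 1)) * (t * (1 + L) ^ m)) := by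
  let S : Fin (m + 2) → Set (Fin (m + 2) → ℝ) := fun j =>
    {y | (∀ i, |y (j.succAbove i)| ≤ |y j|) ∧ |y j| ≤ R ∧
      ∏ i, |y (j.succAbove i)| ≤ t * |y j| ^ (m + 1)}
  have hSm : ∀ j, MeasurableSet (S j) := fun j => by
    have h : IsClosed (S j) := by
      simp only [S, Set.ofPred_and, Set.ofPred_forall]
      exact (isClosed_iInter fun i => isClosed_le (by fun_prop) (by fun_prop)).inter
        ((isClosed_le (by fun_prop) (by fun_prop)).inter (isClosed_le (by fun_prop) (by fun_prop)))
    exact h.measurableSet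
  have hsub : {y : Fin (m + 2) → ℝ | ‖y‖ ≤ R ∧ ∏ i, |y i| ≤ t * ‖y‖ ^ (m + 2)} ⊆ ⋃ j, S j := by
    rintro y ⟨hy, hp⟩
    obtain ⟨j, hj⟩ := exists_abs_eq_norm y
    have hle : ∀ i, |y i| ≤ |y j| := fun i => hj ▸ norm_le_pi_norm y i
    rw [hj] at hy hp
    refine Set.mem_iUnion.2 ⟨j, fun i => hle _, hy, ?_⟩
    rw [Fin.prod_univ_succAbove _ j] at hp
    rcases (abs_nonneg (y j)).eq_or_lt with h0 | h0
    -- Here `y = 0`, and the product has at least one factor.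
    · have : |y (j.succAbove 0)| = 0 := le_antisymm (h0 ▸ hle _) (abs_nonneg _)
      rw [Finset.prod_eq_zero (Finset.mem_univ 0) this]
      positivity
    · refine le_of_mul_le_mul_left (hp.trans (le_of_eq ?_)) h0
      ring
  have hS : ∀ j, volume (S j) ≤
      ENNReal.ofReal ((2 * R) * R ^ (m + 1) * 2 ^ (m + 1) * (t * (1 + L) ^ m)) := by
    intro j
    rw [volume_eq_lintegral_slice j (hSm j)]
    have hslice : ∀ s : ℝ, volume {z : Fin (m + 1) → ℝ |
        j.insertNth (α := fun _ => ℝ) s z ∈ S j} ≤ (Set.Icc (-R) R).indicator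
          (fun _ => ENNReal.ofReal (R ^ (m + 1) * (2 ^ (m + 1) * t * (1 + L) ^ m))) s := by
      intro s
      by_cases hs : s ∈ Set.Icc (-R) R
      · rw [Set.indicator_of_mem hs, ENNReal.ofReal_mul (by positivity)]
        have := volume_scaled_cubeProdSublevel_le (m := m + 1) t s
        refine le_trans (measure_mono ?_) (this.trans (mul_le_mul' (ENNReal.ofReal_le_ofReal ?_)
          (volume_cubeProdSublevel_le m hL0 ht hL)))
        · rintro z ⟨h1, -, h3⟩
          simp only [Fin.insertNth_apply_succAbove, Fin.insertNth_apply_same] at h1 h3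
          exact ⟨h1, h3⟩
        · exact pow_le_pow_left₀ (abs_nonneg _) (abs_le.2 hs) _
      · rw [Set.indicator_of_notMem hs]
        refine le_of_eq (measure_mono_null (t := ∅) ?_ measure_empty)
        rintro z ⟨-, hz, -⟩
        exact hs (abs_le.1 (by simpa using hz))
    refine (lintegral_mono hslice).trans (le_of_eq ?_)
    rw [lintegral_indicator measurableSet_Icc, setLIntegral_const, Real.volume_Icc,
      ← ENNReal.ofReal_mul (by positivity)]
    ring_nf
  calc _ ≤ ∑ j, volume (S j) := (measure_mono hsub).trans (measure_iUnion_fintype_le _ _)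
    _ ≤ ∑ _j : Fin (m + 2), _ := Finset.sum_le_sum fun j _ => hS j
    _ = _ := by
      rw [Finset.sum_const, Finset.card_univ, Fintype.card_fin, nsmul_eq_mul,
        ← ENNReal.ofReal_natCast, ← ENNReal.ofReal_mul (by positivity)]
      push_cast
      ring_nf

/-- The bound of `volume_prod_le_pow_norm_le` transported along a linear isomorphism `T`: the norms
of `x` and `T x` are comparable, and `T` maps `ν` to a multiple of Lebesgue measure. -/
theorem exists_addHaar_prod_le_pow_norm_le {E : Type*} [NormedAddCommGroup E] [NormedSpace ℝ E]
    [FiniteDimensional ℝ E] [MeasurableSpace E] [BorelSpace E] (ν : Measure E)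
    [ν.IsAddHaarMeasure] (m : ℕ) (T : E ≃L[ℝ] (Fin (m + 2) → ℝ)) :
    ∃ C : ℝ, 0 ≤ C ∧ ∀ t L : ℝ, 0 ≤ L → 0 < t → Real.exp (-L) ≤ t →
      ν {x | ‖x‖ ≤ 1 ∧ ∏ i, |T x i| ≤ t * ‖x‖ ^ (m + 2)} ≤
        ENNReal.ofReal (C * (t * (1 + L) ^ m)) := by
  have := T.isAddHaarMeasure_map ν
  have hmap := Measure.isAddLeftInvariant_eq_smul (ν.map T) (volume : Measure (Fin (m + 2) → ℝ))
  set κ := (ν.map T).addHaarScalarFactor (volume : Measure (Fin (m + 2) → ℝ))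
  set R := ‖(T : E →L[ℝ] (Fin (m + 2) → ℝ))‖
  -- The `max` with `1` keeps `exp (-L) ≤ c * t`.
  set c := max 1 (‖(T.symm : (Fin (m + 2) → ℝ) →L[ℝ] E)‖ ^ (m + 2))
  refine ⟨κ * (((m + 2) * (2 * R) * R ^ (m + 1) * 2 ^ (m + 1)) * c), by positivity,
    fun t L hL0 ht hL => ?_⟩
  have hc : 1 ≤ c := le_max_left _ _
  have hsub : {x | ‖x‖ ≤ 1 ∧ ∏ i, |T x i| ≤ t * ‖x‖ ^ (m + 2)} ⊆
      T ⁻¹' {y | ‖y‖ ≤ R ∧ ∏ i, |y i| ≤ (c * t) * ‖y‖ ^ (m + 2)} := by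
    rintro x ⟨hx, hp⟩
    refine ⟨?_, hp.trans ?_⟩
    · exact (T : E →L[ℝ] (Fin (m + 2) → ℝ)).le_of_opNorm_le_of_le le_rfl hx |>.trans_eq (mul_one _)
    · have h1 : ‖x‖ ≤ ‖(T.symm : (Fin (m + 2) → ℝ) →L[ℝ] E)‖ * ‖T x‖ := by
        simpa using (T.symm : (Fin (m + 2) → ℝ) →L[ℝ] E).le_opNorm (T x)
      calc t * ‖x‖ ^ (m + 2)
          ≤ t * (‖(T.symm : (Fin (m + 2) → ℝ) →L[ℝ] E)‖ * ‖T x‖) ^ (m + 2) := by gcongr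
        _ = ‖(T.symm : (Fin (m + 2) → ℝ) →L[ℝ] E)‖ ^ (m + 2) * t * ‖T x‖ ^ (m + 2) := by
          rw [mul_pow]; ring
        _ ≤ c * t * ‖T x‖ ^ (m + 2) := by gcongr; exact le_max_right _ _
  refine (measure_mono hsub).trans ?_
  refine (Measure.le_map_apply T.continuous.measurable.aemeasurable _).trans ?_
  rw [hmap, Measure.smul_apply, ENNReal.smul_def, smul_eq_mul]
  refine (mul_le_mul_right (volume_prod_le_pow_norm_le m (R := R) (norm_nonneg _) hL0
    (by positivity) (hL.trans (le_mul_of_one_le_left ht.le hc))) _).trans (le_of_eq ?_)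
  rw [← ENNReal.ofReal_coe_nnreal, ← ENNReal.ofReal_mul (by positivity)]
  ring_nf

/-! ### The special orthogonal group and its Haar measure -/

/-- `SO(n)` acts transitively on spheres for `n ≥ 2`. The reflection exchanging `v` and `w` has
determinant `-1`; following it by a reflection that fixes `w` gives determinant `1`. -/
theorem exists_specialOrthogonalGroup_map_eq {n : ℕ} (hn : 2 ≤ n) {v w : EuclideanSpace ℝ (Fin n)}
    (h : ‖v‖ = ‖w‖) : ∃ U : Matrix.specialOrthogonalGroup (Fin n) ℝ,
      Matrix.toEuclideanLin (U : Matrix (Fin n) (Fin n) ℝ) v = w := by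
  rcases eq_or_ne v w with rfl | hvw
  · exact ⟨1, by simp⟩
  obtain ⟨u, hu, hu0⟩ : ∃ u ∈ (ℝ ∙ w)ᗮ, u ≠ 0 := by
    refine Submodule.exists_mem_ne_zero_of_ne_bot fun hbot => ?_
    have h1 := (ℝ ∙ w).finrank_add_finrank_orthogonal
    have h2 := finrank_span_le_card (R := ℝ) ({w} : Set (EuclideanSpace ℝ (Fin n)))
    rw [hbot, finrank_bot, finrank_euclideanSpace_fin] at h1
    simp only [Set.toFinset_singleton, Finset.card_singleton] at h2
    omega
  let f : EuclideanSpace ℝ (Fin n) →ₗ[ℝ] EuclideanSpace ℝ (Fin n) :=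
    (ℝ ∙ u)ᗮ.reflection.toLinearMap ∘ₗ (ℝ ∙ (v - w))ᗮ.reflection.toLinearMap
  have hfn : ∀ x y, inner ℝ (f x) (f y) = inner ℝ x y := fun x y => by
    simp [f, LinearIsometryEquiv.inner_map_map]
  have hfd : LinearMap.det f = 1 := by
    rw [LinearMap.det_comp, Submodule.det_reflection, Submodule.det_reflection,
      Submodule.orthogonal_orthogonal, Submodule.orthogonal_orthogonal,
      finrank_span_singleton hu0, finrank_span_singleton (sub_ne_zero.2 hvw)]
    norm_num
  have hfv : f v = w := by
    change (ℝ ∙ u)ᗮ.reflection ((ℝ ∙ (v - w))ᗮ.reflection v) = w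
    rw [Submodule.reflection_sub h, Submodule.reflection_eq_self_iff,
      Submodule.mem_orthogonal_singleton_iff_inner_left]
    exact Submodule.mem_orthogonal_singleton_iff_inner_right.1 hu
  let A : Matrix (Fin n) (Fin n) ℝ := Matrix.toEuclideanLin.symm f
  have hA : Matrix.toEuclideanLin A = f := LinearEquiv.apply_symm_apply _ _
  refine ⟨⟨A, Matrix.mem_specialOrthogonalGroup_iff.2 ⟨?_, ?_⟩⟩, by rw [hA, hfv]⟩
  · rw [Matrix.mem_orthogonalGroup_iff']
    ext i j
    have hij := hfn (EuclideanSpace.single i 1) (EuclideanSpace.single j 1)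
    rw [← hA] at hij
    simp only [EuclideanSpace.inner_eq_star_dotProduct, Matrix.toLpLin_apply, star_trivial,
      PiLp.ofLp_single, Matrix.mulVec_single_one, single_dotProduct, one_mul] at hij
    rw [Matrix.mul_apply, Matrix.one_apply]
    simp only [Pi.single_apply] at hij
    simp only [eq_comm (a := i)]
    refine Eq.trans ?_ hij
    exact Finset.sum_congr rfl fun k _ => mul_comm _ _
  · rw [← hfd, ← hA]
    exact (LinearMap.det_toLpLin 2 A).symm

theorem norm_specialOrthogonalGroup_apply {n : ℕ} (U : Matrix.specialOrthogonalGroup (Fin n) ℝ)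
    (v : EuclideanSpace ℝ (Fin n)) :
    ‖Matrix.toEuclideanLin (U : Matrix (Fin n) (Fin n) ℝ) v‖ = ‖v‖ := by
  have hU := (Matrix.mem_orthogonalGroup_iff' (Fin n) ℝ).1 (U.2.1)
  rw [← sq_eq_sq₀ (norm_nonneg _) (norm_nonneg _), ← real_inner_self_eq_norm_sq,
    ← real_inner_self_eq_norm_sq]
  simp only [EuclideanSpace.inner_eq_star_dotProduct, Matrix.toLpLin_apply, star_trivial]
  rw [Matrix.dotProduct_mulVec, Matrix.vecMul_mulVec, hU, Matrix.vecMul_one]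

instance (n : ℕ) : SecondCountableTopology (Matrix.specialOrthogonalGroup (Fin n) ℝ) :=
  haveI : SecondCountableTopology (Matrix (Fin n) (Fin n) ℝ) :=
    inferInstanceAs (SecondCountableTopology (Fin n → Fin n → ℝ))
  inferInstanceAs (SecondCountableTopology
    ((Matrix.specialOrthogonalGroup (Fin n) ℝ : Set (Matrix (Fin n) (Fin n) ℝ))))

instance (n : ℕ) : IsTopologicalGroup (Matrix.specialOrthogonalGroup (Fin n) ℝ) where
  continuous_inv := Continuous.subtype_mk
    (Continuous.matrix_transpose continuous_subtype_val) _

theorem isCompact_specialOrthogonalGroup (n : ℕ) :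
    IsCompact (Matrix.specialOrthogonalGroup (Fin n) ℝ : Set (Matrix (Fin n) (Fin n) ℝ)) := by
  have hK : IsCompact (Set.univ.pi fun _ : Fin n => Set.univ.pi fun _ : Fin n =>
      Set.Icc (-1 : ℝ) 1) :=
    isCompact_univ_pi fun _ => isCompact_univ_pi fun _ => isCompact_Icc
  refine IsCompact.of_isClosed_subset (X := Matrix (Fin n) (Fin n) ℝ) hK ?_ ?_
  · have : (Matrix.specialOrthogonalGroup (Fin n) ℝ : Set (Matrix (Fin n) (Fin n) ℝ)) =
        {A | A * A.transpose = 1} ∩ {A | A.det = 1} := by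
      ext A
      rw [SetLike.mem_coe, Matrix.mem_specialOrthogonalGroup_iff, Matrix.mem_orthogonalGroup_iff]
      rfl
    rw [this]
    exact (isClosed_eq (by fun_prop) continuous_const).inter
      (isClosed_eq (by fun_prop) continuous_const)
  · intro A hA i _ j _
    have h := congrFun (congrFun ((Matrix.mem_orthogonalGroup_iff (Fin n) ℝ).1 hA.1) i) i
    rw [Matrix.mul_apply, Matrix.one_apply_eq] at h
    refine abs_le.1 (abs_le_one_iff_mul_self_le_one.2 ?_)
    rw [← h]
    exact Finset.single_le_sum (f := fun k => A i k * A.transpose k i)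
      (fun k _ => mul_self_nonneg _) (Finset.mem_univ j)

instance (n : ℕ) : CompactSpace (Matrix.specialOrthogonalGroup (Fin n) ℝ) :=
  isCompact_iff_compactSpace.1 (isCompact_specialOrthogonalGroup n)

/-- A Haar measure on a compact group is right-invariant. -/
theorem isMulRightInvariant_of_compactSpace {G : Type*} [Group G] [TopologicalSpace G]
    [IsTopologicalGroup G] [CompactSpace G] [MeasurableSpace G] [BorelSpace G]
    (μ : Measure G) [μ.IsHaarMeasure] : μ.IsMulRightInvariant := by
  constructor
  intro g
  have h := Measure.isMulInvariant_eq_smul_of_compactSpace (μ.map (· * g)) μ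
  set c := (μ.map (· * g)).haarScalarFactor μ
  have huniv := congrArg (fun ν : Measure G => ν Set.univ) h
  simp only [Measure.smul_apply, ENNReal.smul_def, smul_eq_mul] at huniv
  rw [Measure.map_apply (measurable_mul_const g) MeasurableSet.univ, Set.preimage_univ] at huniv
  have hc : (c : ENNReal) = 1 := by
    rw [← ENNReal.mul_left_inj (c := μ Set.univ) (NeZero.ne _) (measure_ne_top _ _), one_mul]
    exact huniv.symm
  rw [h, ENNReal.coe_eq_one.1 hc, one_smul]

/-! ### Averaging over the rotations -/

/-- The condition is homogeneous in `v`, so `v` may be scaled to the length of `w` and then rotated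
to `w`; the rotation is absorbed by the right-invariance of Haar measure. -/
theorem measure_prod_le_mul_norm_pow_eq {m : ℕ}
    (T : EuclideanSpace ℝ (Fin (m + 2)) ≃L[ℝ] (Fin (m + 2) → ℝ))
    [MeasurableSpace (Matrix.specialOrthogonalGroup (Fin (m + 2)) ℝ)]
    [BorelSpace (Matrix.specialOrthogonalGroup (Fin (m + 2)) ℝ)]
    (μ : Measure (Matrix.specialOrthogonalGroup (Fin (m + 2)) ℝ)) [μ.IsHaarMeasure] (t : ℝ)
    {v w : EuclideanSpace ℝ (Fin (m + 2))} (hv : v ≠ 0) (hw : w ≠ 0) :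
    μ {U | ∏ i, |T (Matrix.toEuclideanLin U.1 v) i| ≤ t * ‖v‖ ^ (m + 2)} =
      μ {U | ∏ i, |T (Matrix.toEuclideanLin U.1 w) i| ≤ t * ‖w‖ ^ (m + 2)} := by
  have := isMulRightInvariant_of_compactSpace μ
  have hv0 := norm_pos_iff.2 hv
  have hw0 := norm_pos_iff.2 hw
  set c := ‖w‖ / ‖v‖
  have hc : 0 < c := div_pos hw0 hv0
  obtain ⟨W, hW⟩ := exists_specialOrthogonalGroup_map_eq (n := m + 2) (by omega)
    (v := c • v) (w := w)
    (by rw [norm_smul, Real.norm_of_nonneg hc.le]; exact div_mul_cancel₀ _ hv0.ne')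
  have hwn : ‖w‖ = c * ‖v‖ := (div_mul_cancel₀ _ hv0.ne').symm
  rw [← measure_preimage_mul_right μ W
    {U | ∏ i, |T (Matrix.toEuclideanLin U.1 v) i| ≤ t * ‖v‖ ^ (m + 2)}]
  congr 1
  ext U
  have hUW : Matrix.toEuclideanLin U.1 w = c • Matrix.toEuclideanLin (U * W).1 v := by
    rw [← hW, map_smul, map_smul, Submonoid.coe_mul, Matrix.toLpLin_mul 2 2 2]
    rfl
  simp only [Set.mem_preimage, Set.mem_ofPred_eq, hUW, hwn, map_smul, Pi.smul_apply, smul_eq_mul,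
    abs_mul, abs_of_pos hc, Finset.prod_mul_distrib, Finset.prod_const, Finset.card_univ,
    Fintype.card_fin, mul_pow]
  rw [mul_left_comm, mul_le_mul_iff_right₀ (pow_pos hc _)]

/-- The left side does not depend on `v`, so it can be computed by averaging over `v` in the unit
ball. By Fubini the average is the mean over `U` of the volume of a set that `U` maps onto the
cone piece of `exists_addHaar_prod_le_pow_norm_le`, and `U` preserves volume. -/
theorem exists_measure_prod_le_mul_norm_pow_le {m : ℕ}
    (T : EuclideanSpace ℝ (Fin (m + 2)) ≃L[ℝ] (Fin (m + 2) → ℝ))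
    [MeasurableSpace (Matrix.specialOrthogonalGroup (Fin (m + 2)) ℝ)]
    [BorelSpace (Matrix.specialOrthogonalGroup (Fin (m + 2)) ℝ)]
    (μ : Measure (Matrix.specialOrthogonalGroup (Fin (m + 2)) ℝ)) [μ.IsHaarMeasure] :
    ∃ C : ℝ, 0 ≤ C ∧ ∀ v : EuclideanSpace ℝ (Fin (m + 2)), v ≠ 0 →
      ∀ t L : ℝ, 0 ≤ L → 0 < t → Real.exp (-L) ≤ t →
      μ {U | ∏ i, |T (Matrix.toEuclideanLin U.1 v) i| ≤ t * ‖v‖ ^ (m + 2)} ≤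
        ENNReal.ofReal (C * (t * (1 + L) ^ m)) := by
  obtain ⟨C, hC, hvol⟩ := exists_addHaar_prod_le_pow_norm_le
    (volume : Measure (EuclideanSpace ℝ (Fin (m + 2)))) m T
  set B := Metric.closedBall (0 : EuclideanSpace ℝ (Fin (m + 2))) 1
  have hB0 : volume B ≠ 0 := (Metric.measure_closedBall_pos _ _ one_pos).ne'
  have hBt : volume B ≠ ⊤ := measure_closedBall_lt_top.ne
  refine ⟨C * μ.real Set.univ / volume.real B, by positivity, fun v hv t L hL0 ht hL => ?_⟩
  set p := μ {U | ∏ i, |T (Matrix.toEuclideanLin U.1 v) i| ≤ t * ‖v‖ ^ (m + 2)}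
  have hact : Continuous fun q : Matrix.specialOrthogonalGroup (Fin (m + 2)) ℝ ×
      EuclideanSpace ℝ (Fin (m + 2)) => Matrix.toEuclideanLin q.1.1 q.2 := by
    simp only [Matrix.toLpLin_apply]
    refine (PiLp.continuous_toLp 2 _).comp (Continuous.matrix_mulVec ?_ ?_)
    · exact continuous_subtype_val.comp continuous_fst
    · exact (PiLp.continuous_ofLp 2 _).comp continuous_snd
  set S : Set (Matrix.specialOrthogonalGroup (Fin (m + 2)) ℝ × EuclideanSpace ℝ (Fin (m + 2))) :=
    {q | ‖q.2‖ ≤ 1 ∧ ∏ i, |T (Matrix.toEuclideanLin q.1.1 q.2) i| ≤ t * ‖q.2‖ ^ (m + 2)}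
  have hS : MeasurableSet S := by
    refine IsClosed.measurableSet (IsClosed.inter
      (isClosed_le (continuous_norm.comp continuous_snd) continuous_const)
      (isClosed_le ?_ (continuous_const.mul ((continuous_norm.comp continuous_snd).pow _))))
    refine continuous_finsetProd _ fun i _ => ?_
    exact ((continuous_apply i).comp (T.continuous.comp hact)).abs
  have h1 : (μ.prod volume) S ≤ ENNReal.ofReal (C * (t * (1 + L) ^ m)) * μ Set.univ := by
    rw [Measure.prod_apply hS, ← lintegral_const]
    refine lintegral_mono fun U => ?_
    let f := LinearIsometry.toLinearIsometryEquiv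
      (⟨Matrix.toEuclideanLin U.1, norm_specialOrthogonalGroup_apply U⟩ :
        EuclideanSpace ℝ (Fin (m + 2)) →ₗᵢ[ℝ] EuclideanSpace ℝ (Fin (m + 2))) rfl
    have hf : Prod.mk U ⁻¹' S = f ⁻¹' {x | ‖x‖ ≤ 1 ∧ ∏ i, |T x i| ≤ t * ‖x‖ ^ (m + 2)} := by
      ext x
      have hx : ‖f x‖ = ‖x‖ := f.norm_map x
      simp only [Set.mem_preimage, Set.mem_ofPred_eq, hx]
      rfl
    rw [hf, f.measurePreserving.measure_preimage_emb f.toHomeomorph.measurableEmbedding]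
    exact hvol t L hL0 ht hL
  have h2 : p * volume B ≤ (μ.prod volume) S := by
    rw [Measure.prod_apply_symm hS,
      ← lintegral_indicator_const Metric.isClosed_closedBall.measurableSet]
    refine lintegral_mono_ae ?_
    filter_upwards [Measure.ae_ne volume (0 : EuclideanSpace ℝ (Fin (m + 2)))] with x hx
    by_cases hxB : x ∈ B
    · rw [Set.indicator_of_mem hxB]
      refine (measure_prod_le_mul_norm_pow_eq T μ t hv hx).le.trans (measure_mono fun U hU => ?_)
      exact ⟨mem_closedBall_zero_iff.1 hxB, hU⟩
    · rw [Set.indicator_of_notMem hxB]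
      exact zero_le
  have h3 : p ≤ ENNReal.ofReal (C * (t * (1 + L) ^ m)) * μ Set.univ / volume B :=
    (ENNReal.le_div_iff_mul_le (Or.inl hB0) (Or.inl hBt)).2 (h2.trans h1)
  refine h3.trans (le_of_eq ?_)
  rw [← ofReal_measureReal (measure_ne_top μ _), ← ofReal_measureReal hBt,
    ← ENNReal.ofReal_mul (by positivity), ← ENNReal.ofReal_div_of_pos]
  · ring_nf
  · exact ENNReal.toReal_pos hB0 hBt

/-! ### Lattice points and the Borel–Cantelli argument -/

/-- The coordinates of a lattice vector in a basis are bounded by a multiple of its norm. -/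
theorem exists_ncard_lattice_ball_le {E : Type*} [NormedAddCommGroup E] [NormedSpace ℝ E]
    [FiniteDimensional ℝ E] (Λ : Submodule ℤ E) [DiscreteTopology Λ] [IsZLattice ℝ Λ] :
    ∃ C : ℝ, 0 ≤ C ∧ ∀ r : ℝ, 1 ≤ r → {γ : Λ | ‖γ‖ ≤ r}.Finite ∧
      ({γ : Λ | ‖γ‖ ≤ r}.ncard : ℝ) ≤ C * r ^ Module.finrank ℝ E := by
  have : Module.Finite ℤ Λ := ZLattice.module_finite ℝ Λ
  have : Module.Free ℤ Λ := ZLattice.module_free ℝ Λ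
  let b := Module.finBasis ℤ Λ
  set β := ZLattice.normBound b
  have hβ : 0 < β := ZLattice.normBound_pos b
  refine ⟨(2 / β + 3) ^ Module.finrank ℝ E, by positivity, fun r hr => ?_⟩
  set N := ⌊r / β⌋₊ + 1
  let F : Finset (Fin (Module.finrank ℤ Λ) → ℤ) := Fintype.piFinset fun _ => Finset.Icc (-N : ℤ) N
  have hmaps : Set.MapsTo (fun γ : Λ => (b.repr γ : Fin (Module.finrank ℤ Λ) → ℤ))
      {γ : Λ | ‖γ‖ ≤ r} F := by
    intro γ hγ
    have hlt : ‖γ‖ < β * N := by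
      refine lt_of_le_of_lt hγ ?_
      rw [mul_comm, ← div_lt_iff₀ hβ]
      push_cast [N]
      exact Nat.lt_floor_add_one _
    simp only [F, Finset.mem_coe, Fintype.mem_piFinset, Finset.mem_Icc]
    exact fun i => abs_le.1 (ZLattice.abs_repr_lt_of_norm_lt b γ N hlt i).le
  have hinj : Set.InjOn (fun γ : Λ => (b.repr γ : Fin (Module.finrank ℤ Λ) → ℤ))
      {γ : Λ | ‖γ‖ ≤ r} := fun x _ y _ h => b.repr.injective (DFunLike.coe_injective h)
  refine ⟨Set.Finite.of_injOn hmaps hinj F.finite_toSet, ?_⟩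
  have hcard := Set.ncard_le_ncard_of_injOn _ hmaps hinj F.finite_toSet
  have hF : F.card = (2 * N + 1) ^ Module.finrank ℝ E := by
    rw [← ZLattice.rank ℝ Λ]
    simp only [F, Fintype.card_piFinset, Int.card_Icc, Finset.prod_const, Finset.card_univ,
      Fintype.card_fin]
    congr 1
    omega
  rw [Set.ncard_coe_finset, hF] at hcard
  calc ({γ : Λ | ‖γ‖ ≤ r}.ncard : ℝ) ≤ ((2 * N + 1) ^ Module.finrank ℝ E : ℕ) := by
        exact_mod_cast hcard
    _ ≤ ((2 / β + 3) * r) ^ Module.finrank ℝ E := by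
        push_cast [N]
        gcongr
        have := Nat.floor_le (div_nonneg (zero_le_one.trans hr) hβ.le)
        have h2 : (2 / β + 3) * r = 2 * (r / β) + 3 * r := by ring
        linarith
    _ = _ := mul_pow _ _ _

variable {m : ℕ}

/-- The event that the product vanishes is contained in the events of
`exists_measure_prod_le_mul_norm_pow_le` with `t = exp (-L)`, for every `L ≥ 0`. -/
theorem ae_prod_ne_zero (T : EuclideanSpace ℝ (Fin (m + 2)) ≃L[ℝ] (Fin (m + 2) → ℝ))
    [MeasurableSpace (Matrix.specialOrthogonalGroup (Fin (m + 2)) ℝ)]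
    [BorelSpace (Matrix.specialOrthogonalGroup (Fin (m + 2)) ℝ)]
    (μ : Measure (Matrix.specialOrthogonalGroup (Fin (m + 2)) ℝ)) [μ.IsHaarMeasure]
    {v : EuclideanSpace ℝ (Fin (m + 2))} (hv : v ≠ 0) :
    ∀ᵐ U ∂μ, ∏ i, |T (Matrix.toEuclideanLin U.1 v) i| ≠ 0 := by
  obtain ⟨C, hC, hb⟩ := exists_measure_prod_le_mul_norm_pow_le T μ
  have hlim : Tendsto (fun L : ℝ => ENNReal.ofReal (C * (Real.exp (-L) * (1 + L) ^ m))) atTop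
      (nhds 0) := by
    have h1 := ((Real.tendsto_pow_mul_exp_neg_atTop_nhds_zero m).comp
      (tendsto_atTop_add_const_left atTop (1 : ℝ) tendsto_id)).const_mul (C * Real.exp 1)
    rw [mul_zero] at h1
    have h2 := ENNReal.tendsto_ofReal h1
    rw [ENNReal.ofReal_zero] at h2
    refine h2.congr fun L => ?_
    simp only [Function.comp, id]
    rw [neg_add, Real.exp_add]
    congr 1
    have : Real.exp 1 * Real.exp (-1) = 1 := by rw [← Real.exp_add]; simp
    linear_combination C * (1 + L) ^ m * Real.exp (-L) * this
  rw [ae_iff]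
  refine le_antisymm (ge_of_tendsto hlim ?_) zero_le
  filter_upwards [eventually_ge_atTop 0] with L hL
  refine (measure_mono fun U hU => ?_).trans (hb v hv _ L hL (Real.exp_pos _) le_rfl)
  simp only [Set.mem_ofPred_eq, not_not, ne_eq] at hU
  rw [Set.mem_ofPred_eq, hU]
  positivity

/-- The first Borel–Cantelli lemma over the dyadic shells `2ᵏ ≤ |γ| < 2ᵏ⁺¹`. -/
theorem ae_eventually_shell_lt_prod
    (T : EuclideanSpace ℝ (Fin (m + 2)) ≃L[ℝ] (Fin (m + 2) → ℝ))
    [MeasurableSpace (Matrix.specialOrthogonalGroup (Fin (m + 2)) ℝ)]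
    [BorelSpace (Matrix.specialOrthogonalGroup (Fin (m + 2)) ℝ)]
    (μ : Measure (Matrix.specialOrthogonalGroup (Fin (m + 2)) ℝ)) [μ.IsHaarMeasure]
    (Λ : Submodule ℤ (EuclideanSpace ℝ (Fin (m + 2)))) [DiscreteTopology Λ] [IsZLattice ℝ Λ]
    {δ : ℝ} (hδ : 0 < δ) :
    ∀ᵐ U ∂μ, ∀ᶠ k : ℕ in atTop, ∀ γ ∈ Λ, 2 ^ k ≤ ‖γ‖ → ‖γ‖ < 2 ^ (k + 1) →
      (k : ℝ) ^ (-(m + 1 + δ)) < ∏ i, |T (Matrix.toEuclideanLin U.1 γ) i| := by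
  obtain ⟨C, hC, hb⟩ := exists_measure_prod_le_mul_norm_pow_le T μ
  obtain ⟨D, hD, hcount⟩ := exists_ncard_lattice_ball_le Λ
  rw [finrank_euclideanSpace_fin] at hcount
  -- The clause `1 ≤ k` discards the junk value of `0 ^ (-(m + 1 + δ))`.
  let E : ℕ → Set (Matrix.specialOrthogonalGroup (Fin (m + 2)) ℝ) := fun k =>
    {U | 1 ≤ k ∧ ∃ γ ∈ Λ, 2 ^ k ≤ ‖γ‖ ∧ ‖γ‖ < 2 ^ (k + 1) ∧
      ∏ i, |T (Matrix.toEuclideanLin U.1 γ) i| ≤ (k : ℝ) ^ (-(m + 1 + δ))}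
  set A : ℝ := (m + 2) * Real.log 2 + (m + 1 + δ)
  have hA : 0 ≤ A := by positivity
  have hE : ∀ k, μ (E k) ≤
      ENNReal.ofReal (D * 2 ^ (m + 2) * C * (1 + A) ^ m * (k : ℝ) ^ (-(1 + δ))) := by
    intro k
    rcases Nat.eq_zero_or_pos k with rfl | hk
    · refine le_of_eq_of_le (measure_mono_null (t := ∅) ?_ measure_empty) zero_le
      rintro U ⟨h, -⟩
      omega
    have hk0 : (0 : ℝ) < k := by exact_mod_cast hk
    have hk1 : (1 : ℝ) ≤ k := by exact_mod_cast hk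
    obtain ⟨hfin, hcard⟩ := hcount (2 ^ (k + 1)) (one_le_pow₀ one_le_two)
    -- `τ` is chosen so that `k ^ (-(m + 1 + δ)) ≤ τ * ‖γ‖ ^ (m + 2)` on the `k`-th shell.
    set τ : ℝ := (k : ℝ) ^ (-(m + 1 + δ)) / (2 ^ k) ^ (m + 2)
    have hτ : 0 < τ := by positivity
    -- As `log k ≤ k`, the logarithm of `1 / τ` grows at most linearly in `k`.
    have hτL : Real.exp (-(A * k)) ≤ τ := by
      rw [← Real.le_log_iff_exp_le hτ, Real.log_div (by positivity) (by positivity),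
        Real.log_rpow hk0, Real.log_pow, Real.log_pow]
      have h1 : Real.log k ≤ k := (Real.log_le_sub_one_of_pos hk0).trans (by linarith)
      have h2 : (m + 1 + δ) * Real.log k ≤ (m + 1 + δ) * k :=
        mul_le_mul_of_nonneg_left h1 (by positivity)
      push_cast [A]
      linarith
    have hp : ∀ γ ∈ hfin.toFinset, μ {U | 2 ^ k ≤ ‖γ‖ ∧
        ∏ i, |T (Matrix.toEuclideanLin U.1 γ) i| ≤ (k : ℝ) ^ (-(m + 1 + δ))} ≤
        ENNReal.ofReal (C * (τ * (1 + A * k) ^ m)) := by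
      intro γ _
      by_cases hγ : 2 ^ k ≤ ‖γ‖
      · have hγ0 : (γ : EuclideanSpace ℝ (Fin (m + 2))) ≠ 0 := by
          rw [← norm_pos_iff]
          exact (pow_pos two_pos k).trans_le hγ
        refine (measure_mono ?_).trans (hb γ hγ0 τ (A * k) (by positivity) hτ hτL)
        rintro U ⟨-, hU⟩
        refine hU.trans ?_
        rw [div_mul_eq_mul_div, le_div_iff₀ (by positivity)]
        gcongr
        exact hγ
      · refine le_of_eq_of_le (measure_mono_null (t := ∅) ?_ measure_empty) zero_le
        rintro U ⟨h, -⟩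
        exact hγ h
    have hsub : E k ⊆ ⋃ γ ∈ hfin.toFinset, {U | 2 ^ k ≤ ‖γ‖ ∧
        ∏ i, |T (Matrix.toEuclideanLin U.1 γ) i| ≤ (k : ℝ) ^ (-(m + 1 + δ))} := by
      rintro U ⟨-, γ, hγ, h1, h2, h3⟩
      simp only [Set.mem_iUnion]
      exact ⟨⟨γ, hγ⟩, hfin.mem_toFinset.2 h2.le, h1, h3⟩
    calc μ (E k) ≤ ∑ γ ∈ hfin.toFinset, _ :=
          (measure_mono hsub).trans (measure_biUnion_finset_le _ _)
      _ ≤ ∑ _γ ∈ hfin.toFinset, ENNReal.ofReal (C * (τ * (1 + A * k) ^ m)) :=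
          Finset.sum_le_sum hp
      _ = ENNReal.ofReal ({γ : Λ | ‖γ‖ ≤ 2 ^ (k + 1)}.ncard * (C * (τ * (1 + A * k) ^ m))) := by
          rw [Finset.sum_const, nsmul_eq_mul, ← Set.ncard_eq_toFinset_card _ hfin,
            ENNReal.ofReal_mul (Nat.cast_nonneg _), ENNReal.ofReal_natCast]
      _ ≤ _ := by
          apply ENNReal.ofReal_le_ofReal
          calc _ ≤ D * (2 ^ (k + 1)) ^ (m + 2) * (C * (τ * ((1 + A) * k) ^ m)) := by
                gcongr
                nlinarith
            _ = D * 2 ^ (m + 2) * C * (1 + A) ^ m * ((k : ℝ) ^ (-(m + 1 + δ)) * (k : ℝ) ^ m) := by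
                simp only [τ, mul_pow, pow_succ (2 : ℝ) k]
                field_simp
            _ = _ := by
                rw [← Real.rpow_natCast (k : ℝ) m, ← Real.rpow_add hk0]
                ring_nf
  have hsum : ∑' k, μ (E k) ≠ ⊤ := by
    have hs : Summable fun k : ℕ =>
        D * 2 ^ (m + 2) * C * (1 + A) ^ m * (k : ℝ) ^ (-(1 + δ)) :=
      (Real.summable_nat_rpow.2 (by linarith)).mul_left _
    exact ne_top_of_le_ne_top hs.tsum_ofReal_ne_top (ENNReal.tsum_le_tsum hE)
  filter_upwards [ae_eventually_notMem hsum] with U hU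
  filter_upwards [hU, eventually_ge_atTop 1] with k hk hk1 γ hγ h1 h2
  by_contra! h3
  exact hk ⟨hk1, γ, hγ, h1, h2, h3⟩

/-! ### From shells to the Diophantine characteristic -/

/-- The deterministic part: a lower bound for the norm form on all but finitely many dyadic shells,
together with its non-vanishing, bounds the Diophantine characteristic of the image lattice. -/
theorem eventually_lt_diophantineChar {n : ℕ} (hn : 1 ≤ n)
    (Λ : Submodule ℤ (EuclideanSpace ℝ (Fin n))) [DiscreteTopology Λ]
    (A : Matrix (Fin n) (Fin n) ℝ) (hΛ : ∃ γ ∈ Λ, γ ≠ 0) {K : ℝ} (hK : 0 < K)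
    (hA : ∀ x, ‖x‖ ≤ K * ‖Matrix.toEuclideanLin A x‖)
    (hne : ∀ γ ∈ Λ, γ ≠ 0 → normForm (Matrix.toEuclideanLin A γ) ≠ 0) {δ ε : ℝ} (hδ : 0 < δ)
    (hδε : δ < ε) (hshell : ∀ᶠ k : ℕ in atTop, ∀ γ ∈ Λ, 2 ^ k ≤ ‖γ‖ → ‖γ‖ < 2 ^ (k + 1) →
      (k : ℝ) ^ (1 - (n : ℝ) - δ) < |normForm (Matrix.toEuclideanLin A γ)|) :
    ∀ᶠ ρ : ℝ in atTop, diophantineChar (matrixImage A Λ) ρ > Real.log ρ ^ (1 - (n : ℝ) - ε) := by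
  have hn' : (1 : ℝ) ≤ n := by exact_mod_cast hn
  obtain ⟨k₀, hk₀⟩ := eventually_atTop.1 (hshell.and (eventually_ge_atTop 1))
  -- The finitely many lattice vectors outside the shells `k ≥ k₀`.
  obtain ⟨c, hc, hsmall⟩ : ∃ c > 0, ∀ γ ∈ Λ, γ ≠ 0 → ‖γ‖ < 2 ^ k₀ →
      c ≤ |normForm (Matrix.toEuclideanLin A γ)| := by
    have hfin : {γ | γ ∈ Λ ∧ γ ≠ 0 ∧ ‖γ‖ < 2 ^ k₀}.Finite := by
      have : DiscreteTopology Λ.toAddSubgroup := inferInstanceAs (DiscreteTopology Λ)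
      refine (Metric.finite_isBounded_inter_isClosed DiscreteTopology.isDiscrete
        (Metric.isBounded_closedBall (x := (0 : EuclideanSpace ℝ (Fin n))) (r := 2 ^ k₀))
        (AddSubgroup.isClosed_of_discrete (H := Λ.toAddSubgroup))).subset ?_
      rintro γ ⟨h1, -, h3⟩
      exact ⟨mem_closedBall_zero_iff.2 h3.le, h1⟩
    rcases Set.eq_empty_or_nonempty {γ | γ ∈ Λ ∧ γ ≠ 0 ∧ ‖γ‖ < 2 ^ k₀} with h | h
    · exact ⟨1, one_pos, fun γ h1 h2 h3 => (Set.eq_empty_iff_forall_notMem.1 h γ ⟨h1, h2, h3⟩).elim⟩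
    · obtain ⟨γ₀, ⟨h1, h2, -⟩, hmin⟩ := Set.exists_min_image _
        (fun γ => |normForm (Matrix.toEuclideanLin A γ)|) hfin h
      exact ⟨_, abs_pos.2 (hne γ₀ h1 h2), fun γ h1 h2 h3 => hmin γ ⟨h1, h2, h3⟩⟩
  -- For large `ρ`, a vector of the `k`-th shell whose image is shorter than `ρ` has
  -- `k ≤ B * log ρ`.
  set B : ℝ := 2 / Real.log 2
  have hlog2 : 0 < Real.log 2 := Real.log_pos one_lt_two
  have hB : 0 < B := by positivity
  obtain ⟨γ₁, hγ₁, hγ₁0⟩ := hΛ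
  have hlim : ∀ e : ℝ, 0 < e → ∀ b > 0, ∀ᶠ ρ : ℝ in atTop, Real.log ρ ^ (-e) < b :=
    fun e he b hb =>
      ((tendsto_rpow_neg_atTop he).comp Real.tendsto_log_atTop).eventually_lt_const hb
  filter_upwards [hlim (n - 1 + ε) (by linarith) c hc,
    hlim (ε - δ) (by linarith) (B ^ (1 - (n : ℝ) - δ)) (by positivity),
    Real.tendsto_log_atTop.eventually_ge_atTop (Real.log K),
    Real.tendsto_log_atTop.eventually_ge_atTop 1, eventually_gt_atTop 0,
    eventually_gt_atTop ‖Matrix.toEuclideanLin A γ₁‖] with ρ h1 h2 h3 h4 h5 h6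
  have hℓ : 0 < Real.log ρ := one_pos.trans_le h4
  have hc' : Real.log ρ ^ (1 - (n : ℝ) - ε) < c := by
    convert! h1 using 2
    ring
  have hB' : Real.log ρ ^ (1 - (n : ℝ) - ε) < (B * Real.log ρ) ^ (1 - (n : ℝ) - δ) := by
    rw [Real.mul_rpow hB.le hℓ.le, show 1 - (n : ℝ) - ε = -(ε - δ) + (1 - n - δ) by ring,
      Real.rpow_add hℓ]
    exact mul_lt_mul_of_pos_right h2 (by positivity)
  -- The set of values has to be nonempty, as `sInf ∅ = 0`.
  refine lt_of_lt_of_le (lt_min hc' hB') (le_csInf ?_ ?_)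
  · refine ⟨_, Matrix.toEuclideanLin A γ₁, ⟨γ₁, hγ₁, rfl⟩, ?_, h6, rfl⟩
    by_contra! h
    have := (hA γ₁).trans (mul_nonpos_of_nonneg_of_nonpos hK.le h)
    exact hγ₁0 (norm_le_zero_iff.1 this)
  · rintro _ ⟨_, ⟨γ, hγ, rfl⟩, hpos, hlt, rfl⟩
    change _ ≤ |normForm (Matrix.toEuclideanLin A γ)|
    change 0 < ‖Matrix.toEuclideanLin A γ‖ at hpos
    change ‖Matrix.toEuclideanLin A γ‖ < ρ at hlt
    have hγ0 : γ ≠ 0 := by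
      rintro rfl
      simp at hpos
    rcases lt_or_ge ‖γ‖ (2 ^ k₀) with hs | hs
    · exact (min_le_left _ _).trans (hsmall γ hγ hγ0 hs)
    · obtain ⟨k, hk1, hk2⟩ := exists_nat_pow_near ((one_le_pow₀ one_le_two).trans hs)
        (one_lt_two : (1 : ℝ) < 2)
      have hkk : k₀ ≤ k := by
        have := (pow_lt_pow_iff_right₀ (one_lt_two : (1 : ℝ) < 2)).1 (hs.trans_lt hk2)
        omega
      obtain ⟨hk, hk'⟩ := hk₀ k hkk
      refine (min_le_right _ _).trans (le_trans ?_ (hk γ hγ hk1 hk2).le)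
      refine Real.rpow_le_rpow_of_nonpos (by exact_mod_cast hk') ?_ (by linarith)
      have hle : (2 : ℝ) ^ k ≤ K * ρ := hk1.trans ((hA γ).trans (by gcongr))
      have hlog := Real.log_le_log (by positivity) hle
      rw [Real.log_pow, Real.log_mul hK.ne' h5.ne'] at hlog
      rw [div_mul_eq_mul_div, le_div_iff₀ hlog2]
      linarith

/-- The linear map `x ↦ P x` from Euclidean space to `Fin n → ℝ` with the supremum norm. -/
noncomputable def mulVecEquiv {n : ℕ} (P : Matrix.GeneralLinearGroup (Fin n) ℝ) :
    EuclideanSpace ℝ (Fin n) ≃L[ℝ] (Fin n → ℝ) :=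
  (EuclideanSpace.equiv (Fin n) ℝ).trans
    (Matrix.toLin'OfInv (M := ((P⁻¹ : Matrix.GeneralLinearGroup (Fin n) ℝ) :
      Matrix (Fin n) (Fin n) ℝ)) (M' := (P : Matrix (Fin n) (Fin n) ℝ)) P.inv_mul
      P.mul_inv).toContinuousLinearEquiv

theorem mulVecEquiv_apply {n : ℕ} (P : Matrix.GeneralLinearGroup (Fin n) ℝ)
    (x : EuclideanSpace ℝ (Fin n)) :
    mulVecEquiv P x = (P : Matrix (Fin n) (Fin n) ℝ).mulVec x.ofLp := by
  rfl

theorem toEuclideanLin_mul_apply {n : ℕ} (P : Matrix.GeneralLinearGroup (Fin n) ℝ)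
    (U : Matrix (Fin n) (Fin n) ℝ) (x : EuclideanSpace ℝ (Fin n)) (i : Fin n) :
    Matrix.toEuclideanLin ((P : Matrix (Fin n) (Fin n) ℝ) * U) x i =
      mulVecEquiv P (Matrix.toEuclideanLin U x) i := by
  rw [mulVecEquiv_apply, Matrix.toLpLin_apply, Matrix.toLpLin_apply, Matrix.mulVec_mulVec]

theorem exists_norm_le_mul_norm_toEuclideanLin {n : ℕ} (P : Matrix.GeneralLinearGroup (Fin n) ℝ)
    (U : Matrix.specialOrthogonalGroup (Fin n) ℝ) :
    ∃ K > 0, ∀ x, ‖x‖ ≤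
      K * ‖Matrix.toEuclideanLin ((P : Matrix (Fin n) (Fin n) ℝ) * U.1) x‖ := by
  set S : (Fin n → ℝ) →L[ℝ] EuclideanSpace ℝ (Fin n) :=
    ((mulVecEquiv P).symm : (Fin n → ℝ) →L[ℝ] EuclideanSpace ℝ (Fin n))
  refine ⟨‖S‖ + 1, by positivity, fun x => ?_⟩
  set y := mulVecEquiv P (Matrix.toEuclideanLin U.1 x)
  have hy : S y = Matrix.toEuclideanLin U.1 x := (mulVecEquiv P).symm_apply_apply _
  have hyn : ‖y‖ ≤ ‖Matrix.toEuclideanLin ((P : Matrix (Fin n) (Fin n) ℝ) * U.1) x‖ := by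
    refine (pi_norm_le_iff_of_nonneg (norm_nonneg _)).2 fun i => ?_
    rw [show y i = _ from (toEuclideanLin_mul_apply P U.1 x i).symm]
    exact PiLp.norm_apply_le _ i
  calc ‖x‖ = ‖S y‖ := by rw [hy, norm_specialOrthogonalGroup_apply]
    _ ≤ ‖S‖ * ‖y‖ := S.le_opNorm y
    _ ≤ _ := by gcongr; linarith

theorem ZLattice.exists_mem_ne_zero {E : Type*} [NormedAddCommGroup E] [NormedSpace ℝ E]
    [Nontrivial E] (Λ : Submodule ℤ E) [DiscreteTopology Λ] [IsZLattice ℝ Λ] : ∃ γ ∈ Λ, γ ≠ 0 := by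
  by_contra! h
  have hspan := IsZLattice.span_top (K := ℝ) (L := Λ)
  exact bot_ne_top (α := Submodule ℝ E)
    ((Submodule.span_eq_bot.2 fun x hx => h x hx).symm.trans hspan)

theorem lemma4p1 (n : ℕ) (hn : 1 ≤ n)
    (Λ : Submodule ℤ (EuclideanSpace ℝ (Fin n))) [DiscreteTopology Λ] [IsZLattice ℝ Λ]
    (hΛ : ZLattice.covolume Λ MeasureTheory.volume = 1)
    (P : Matrix.GeneralLinearGroup (Fin n) ℝ)
    [MeasurableSpace (Matrix.specialOrthogonalGroup (Fin n) ℝ)]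
    [BorelSpace (Matrix.specialOrthogonalGroup (Fin n) ℝ)]
    (μ : MeasureTheory.Measure (Matrix.specialOrthogonalGroup (Fin n) ℝ))
    [μ.IsHaarMeasure] :
    ∀ᵐ U : Matrix.specialOrthogonalGroup (Fin n) ℝ ∂μ, ∀ ε : ℝ, 0 < ε → ∀ᶠ ρ : ℝ in Filter.atTop,
      diophantineChar
          (matrixImage ((P : Matrix (Fin n) (Fin n) ℝ) * (U : Matrix (Fin n) (Fin n) ℝ)) Λ) ρ
        > Real.log ρ ^ (1 - (n : ℝ) - ε) := by
  rcases n with _ | _ | m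
  · omega
  · refine Filter.Eventually.of_forall fun U ε hε => ?_
    obtain ⟨K, hK, hKU⟩ := exists_norm_le_mul_norm_toEuclideanLin P U
    have hnorm : ∀ x : EuclideanSpace ℝ (Fin 1), |normForm x| = ‖x‖ := fun x => by
      simp [normForm, EuclideanSpace.norm_eq, Real.sqrt_sq_eq_abs]
    refine eventually_lt_diophantineChar hn Λ _ (ZLattice.exists_mem_ne_zero Λ) hK hKU
      (fun γ _ hγ0 => ?_) (half_pos hε) (half_lt_self hε) ?_
    · rw [← abs_pos, hnorm]
      exact pos_of_mul_pos_right ((norm_pos_iff.2 hγ0).trans_le (hKU γ)) hK.le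
    · filter_upwards [(tendsto_pow_atTop_atTop_of_one_lt
        (one_lt_two : (1 : ℝ) < 2)).eventually_gt_atTop K,
        Filter.eventually_ge_atTop 1] with k hk hk1 γ _ hγ _
      rw [hnorm]
      have h1 : (k : ℝ) ^ (1 - ((0 + 1 : ℕ) : ℝ) - ε / 2) ≤ 1 :=
        Real.rpow_le_one_of_one_le_of_nonpos (by exact_mod_cast hk1) (by push_cast; linarith)
      refine h1.trans_lt ?_
      by_contra! h
      exact absurd (hk.trans_le (hγ.trans (hKU γ))) (by nlinarith)
  · have hprod : ∀ (U : Matrix (Fin (m + 2)) (Fin (m + 2)) ℝ) x,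
        |normForm (Matrix.toEuclideanLin ((P : Matrix (Fin (m + 2)) (Fin (m + 2)) ℝ) * U) x)| =
        ∏ i, |mulVecEquiv P (Matrix.toEuclideanLin U x) i| := fun U x => by
      simp only [normForm, Finset.abs_prod, toEuclideanLin_mul_apply]
    have hne : ∀ᵐ U ∂μ, ∀ γ : Λ, γ ≠ 0 →
        ∏ i, |mulVecEquiv P (Matrix.toEuclideanLin U.1 γ) i| ≠ 0 := by
      rw [ae_all_iff]
      intro γ
      by_cases hγ : γ = 0
      · simp [hγ]
      · filter_upwards [ae_prod_ne_zero (mulVecEquiv P) μ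
          (v := (γ : EuclideanSpace ℝ (Fin (m + 2)))) (by simpa using hγ)] with U hU _ using hU
    -- Countably many exponents `δ` suffice to reach every `ε > 0`.
    have hshell := ae_all_iff.2 fun j : ℕ => ae_eventually_shell_lt_prod (mulVecEquiv P) μ Λ
      (δ := 1 / ((j : ℝ) + 1)) (by positivity)
    filter_upwards [hne, hshell] with U hU1 hU2 ε hε
    obtain ⟨j, hj⟩ := exists_nat_one_div_lt hε
    obtain ⟨K, hK, hKU⟩ := exists_norm_le_mul_norm_toEuclideanLin P U
    refine eventually_lt_diophantineChar hn Λ _ (ZLattice.exists_mem_ne_zero Λ) hK hKU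
      (fun γ hγ hγ0 => ?_) (δ := 1 / ((j : ℝ) + 1)) (by positivity) hj ?_
    · rw [← abs_ne_zero, hprod]
      exact hU1 ⟨γ, hγ⟩ (by simpa [Subtype.ext_iff] using hγ0)
    · filter_upwards [hU2 j] with k hk γ hγ h1 h2
      rw [hprod]
      convert! hk γ hγ h1 h2 using 2
      push_cast
      ring
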